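/- Let $p$ be a prime number, $n\ge 1$ an integer, $X$ a totally ordered set, and $S$ a free profinite group on the basis $X$ (the map $X\to S$ converges to $1$, i.e. every neighbourhood of $1$ contains the images of almost all $x\in X$; its image topologically generates $S$; and every map from $X$ to a profinite group that converges to $1$ extends uniquely to a continuous homomorphism on $S$). For a profinite group $G$, closed subgroups $K,K'$ and $m\ge1$, let $[K,K']$ (resp. $K^m$) be the closed subgroup generated by all commutators $[k,k']=k^{-1}k'^{-1}kk'$ (resp. all powers $k^m$) with $k\in K$, $k'\in K'$. Let $G^{(1)}=G$, $G^{(i+1)}=[G,G^{(i)}]$, and let $G_{(n,p)}$ be the closed subgroup generated by all $g^{p^j}$ with $g\in G^{(i)}$, $i\ge1$, $j\ge0$, $ip^j\ge n$ (the $p$-Zassenhaus filtration). Let $X^*$ be the free monoid and $\mathcal M_X$ the free magma on $X$, and let $f\colon\mathcal M_X\to X^*$ be the map that drops brackets. A Hall set in $\mathcal M_X$ is a subset $\mathcal H\subseteq\mathcal M_X$ with a total order $\le$ on $\mathcal H$ such that: (1) $X\subseteq\mathcal H$ as ordered sets; (2) if $h=(h'h'')\in\mathcal H\setminus X$, then $h''\in\mathcal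 H$ and $h<h''$; (3) for $h=(h'h'')\in\mathcal M_X\setminus X$ one has $h\in\mathcal H$ if and only if $h',h''\in\mathcal H$, $h'<h''$, and either $h'\in X$ or $h'=(h_1h_2)$ with $h_2\ge h''$. Then $H=f(\mathcal H)$ is called a Hall set in $X^*$. Each $w\in H$ is $f(h)$ for a unique $h\in\mathcal H$; if $h=(h'h'')$, the standard factorization of $w$ is $w=uv$ with $u=f(h')$, $v=f(h'')$ in $H$. Define $\tau_w\in S$ for $w\in H$ by $\tau_{(x)}=x$ for $x\in X$, and $\tau_w=[\tau_u,\tau_v]$ if $w=uv$ is the standard factorization of $w$. For $1\le i\le n$ let $j_n(i)$ be the least integer $j$ with $ip^j\ge n$, and let $J(n)$ be the set of all $1\le i\le n$ such that $i'p^{j_n(i')}\ge ip^{j_n(i)}$ for every $1\le i'\le i$ (equivalently, $i=\lceil n/p^k\rceil$ for some $k\ge0$). For $w\in H$ of length $1\le i\le n$ put $\sigma_w=\tau_w^{p^{j_n(i)}}\in S_{(n,p)}$. Theorem. For every Hall set $H$ in $X^*$, the cosets of $\sigma_w$, where $w\in H$ has length $i\in J(n)$, generate the profinite group $S_{(n,p)}/(S_{(n,p)})^p[S,S_{(n,p)}]$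 topologically. -/

import Mathlib

open Topology
open scoped commutatorElement

universe u v

namespace Zassenhaus

/-! ## Hall sets -/

section Hall

variable {X : Type v}

/-- The foliage (brackets dropping) map from the free magma on `X` to the free monoid on `X`. -/
def foliage : FreeMagma X →ₙ* FreeMonoid X := FreeMagma.lift FreeMonoid.of

/-- `(ℋ, le)` is a Hall set in the free magma on the totally ordered alphabet `X`. Only the
restriction of `le` to `ℋ` matters; there it is a total order. The strict relation `a < b` is
spelled out as `le a b ∧ a ≠ b`. -/
structure IsHallSet [LinearOrder X] (ℋ : Set (FreeMagma X))
    (le : FreeMagma X → FreeMagma X → Prop) : Prop where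
  le_refl : ∀ a ∈ ℋ, le a a
  le_trans : ∀ a ∈ ℋ, ∀ b ∈ ℋ, ∀ c ∈ ℋ, le a b → le b c → le a c
  le_antisymm : ∀ a ∈ ℋ, ∀ b ∈ ℋ, le a b → le b a → a = b
  le_total : ∀ a ∈ ℋ, ∀ b ∈ ℋ, le a b ∨ le b a
  of_mem : ∀ x : X, FreeMagma.of x ∈ ℋ
  of_le_of : ∀ x y : X, le (FreeMagma.of x) (FreeMagma.of y) ↔ x ≤ y
  lt_right : ∀ a b : FreeMagma X, a * b ∈ ℋ → b ∈ ℋ ∧ le (a * b) b ∧ a * b ≠ b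
  mul_mem_iff : ∀ a b : FreeMagma X, a * b ∈ ℋ ↔
    (a ∈ ℋ ∧ b ∈ ℋ ∧ le a b ∧ a ≠ b) ∧
      ((∃ x : X, a = FreeMagma.of x) ∨ ∃ a₁ a₂ : FreeMagma X, a = a₁ * a₂ ∧ le b a₂)

/-- The Hall set `H = f(ℋ)` of associative words attached to a set `ℋ` of trees. -/
def hallWords (ℋ : Set (FreeMagma X)) : Set (FreeMonoid X) := foliage '' ℋ

open Classical in
/-- Auxiliary: insert a tree on the left of a list of trees, merging it with the head as long as
it is smaller than the head. Only used to prove that foliage is injective on Hall sets. -/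
noncomputable def insertTree (le : FreeMagma X → FreeMagma X → Prop) :
    FreeMagma X → List (FreeMagma X) → List (FreeMagma X)
  | t, [] => [t]
  | t, g :: L => if le t g ∧ t ≠ g then insertTree le (t * g) L else t :: g :: L

/-- Auxiliary: the list of Hall trees obtained by inserting the letters of a word one by one. -/
noncomputable def normalList (le : FreeMagma X → FreeMagma X → Prop) :
    List X → List (FreeMagma X)
  | [] => []
  | x :: l => insertTree le (FreeMagma.of x) (normalList le l)

theorem normalList_append [LinearOrder X] {ℋ : Set (FreeMagma X)}
    {le : FreeMagma X → FreeMagma X → Prop} (hH : IsHallSet ℋ le) (h : FreeMagma X) :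
    h ∈ ℋ → ∀ w : List X, (∀ g ∈ normalList le w, g ∈ ℋ) →
      (∀ a b, h = a * b → ∀ g ∈ normalList le w, le g b) →
      normalList le ((foliage h).toList ++ w) = insertTree le h (normalList le w) := by
  induction h using FreeMagma.recOnMul with
  | ih1 x => intro _ w _ _; rfl
  | ih2 a b iha ihb =>
    intro hab w hw hle
    obtain ⟨⟨ha, hb, hlt, hne⟩, hstd⟩ := (hH.mul_mem_iff a b).1 hab
    have hle' := hle a b rfl
    have e1 : normalList le ((foliage b).toList ++ w) = b :: normalList le w := by
      rw [ihb hb w hw]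
      · cases hL : normalList le w with
        | nil => rfl
        | cons g L =>
          have hg : g ∈ normalList le w := by simp [hL]
          have : ¬ (le b g ∧ b ≠ g) := fun hc =>
            hc.2 (hH.le_antisymm b hb g (hw g hg) hc.1 (hle' g hg))
          simp [insertTree, this]
      · intro c d hcd g hg
        subst hcd
        obtain ⟨hd, hcdd, _⟩ := hH.lt_right c d hb
        exact hH.le_trans g (hw g hg) _ hb d hd (hle' g hg) hcdd
    have e2 : normalList le ((foliage a).toList ++ ((foliage b).toList ++ w)) =
        insertTree le a (b :: normalList le w) := by
      rw [iha ha, e1]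
      · intro g hg
        rw [e1] at hg
        rcases List.mem_cons.1 hg with rfl | hg
        · exact hb
        · exact hw g hg
      · intro c d hcd g hg
        rw [e1] at hg
        subst hcd
        have hbd : le b d := by
          rcases hstd with ⟨x, hx⟩ | ⟨a₁, a₂, h12, hb2⟩
          · exact absurd hx (by rintro ⟨⟩)
          · have : d = a₂ := by
              have := h12
              change FreeMagma.mul c d = FreeMagma.mul a₁ a₂ at this
              injection this
            rw [this]; exact hb2
        rcases List.mem_cons.1 hg with rfl | hg
        · exact hbd
        · exact hH.le_trans g (hw g hg) b hb d (hH.lt_right c d ha).1 (hle' g hg) hbd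
    rw [map_mul, FreeMonoid.toList_mul, List.append_assoc, e2]
    simp [insertTree, hlt, hne]

/-- Every word of a Hall set is the foliage of a unique Hall tree. -/
theorem IsHallSet.foliage_injOn [LinearOrder X] {ℋ : Set (FreeMagma X)}
    {le : FreeMagma X → FreeMagma X → Prop} (hH : IsHallSet ℋ le) : Set.InjOn foliage ℋ := by
  have key : ∀ h ∈ ℋ, normalList le (foliage h).toList = [h] := by
    intro h hh
    have := normalList_append hH h hh [] (by simp [normalList]) (by simp [normalList])
    simpa [normalList, insertTree] using this
  intro a ha b hb hab
  have h1 := key a ha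
  rw [hab, key b hb] at h1
  exact (List.cons.inj h1).1.symm

/-- The tree `h ∈ ℋ` with foliage the given word `w ∈ H`; it is unique when `ℋ` is a Hall set. -/
noncomputable def hallTree (ℋ : Set (FreeMagma X)) (w : hallWords ℋ) : FreeMagma X :=
  w.2.choose

theorem hallTree_mem (ℋ : Set (FreeMagma X)) (w : hallWords ℋ) : hallTree ℋ w ∈ ℋ :=
  w.2.choose_spec.1

theorem foliage_hallTree (ℋ : Set (FreeMagma X)) (w : hallWords ℋ) :
    foliage (hallTree ℋ w) = w :=
  w.2.choose_spec.2

theorem IsHallSet.hallTree_eq [LinearOrder X] {ℋ : Set (FreeMagma X)}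
    {le : FreeMagma X → FreeMagma X → Prop} (hH : IsHallSet ℋ le) (w : hallWords ℋ)
    {h : FreeMagma X} (hh : h ∈ ℋ) (hw : foliage h = w) : hallTree ℋ w = h :=
  hH.foliage_injOn (hallTree_mem ℋ w) hh ((foliage_hallTree ℋ w).trans hw.symm)

/-- The iterated commutator along a tree: a letter `x` goes to `ι x`, and `(a b)` goes to
`[s, t] = s⁻¹ t⁻¹ s t`, where `s`, `t` are the elements attached to `a`, `b`. -/
def treeComm {S : Type*} [Group S] (ι : X → S) : FreeMagma X → S
  | FreeMagma.of x => ι x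
  | FreeMagma.mul a b => (treeComm ι a)⁻¹ * (treeComm ι b)⁻¹ * treeComm ι a * treeComm ι b

/-- The element `τ_w` for a word `w` of the Hall set. -/
noncomputable def tau {S : Type*} [Group S] (ι : X → S) (ℋ : Set (FreeMagma X))
    (w : hallWords ℋ) : S :=
  treeComm ι (hallTree ℋ w)

/-- `τ_(x) = x`. -/
theorem IsHallSet.tau_of [LinearOrder X] {S : Type*} [Group S] (ι : X → S)
    {ℋ : Set (FreeMagma X)} {le : FreeMagma X → FreeMagma X → Prop} (hH : IsHallSet ℋ le)
    (x : X) (w : hallWords ℋ) (hw : (w : FreeMonoid X) = FreeMonoid.of x) :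
    tau ι ℋ w = ι x := by
  rw [tau, hH.hallTree_eq w (hH.of_mem x) hw.symm]
  rfl

/-- `τ_w = [τ_u, τ_v]` if `w = uv` is the standard factorization of `w`. -/
theorem IsHallSet.tau_mul [LinearOrder X] {S : Type*} [Group S] (ι : X → S)
    {ℋ : Set (FreeMagma X)} {le : FreeMagma X → FreeMagma X → Prop} (hH : IsHallSet ℋ le)
    (a b : FreeMagma X) (hab : a * b ∈ ℋ) (w u v : hallWords ℋ)
    (hw : foliage (a * b) = w) (hu : foliage a = u) (hv : foliage b = v) :
    tau ι ℋ w = (tau ι ℋ u)⁻¹ * (tau ι ℋ v)⁻¹ * tau ι ℋ u * tau ι ℋ v := by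
  obtain ⟨⟨ha, hb, -⟩, -⟩ := (hH.mul_mem_iff a b).1 hab
  rw [tau, tau, tau, hH.hallTree_eq w hab hw, hH.hallTree_eq u ha hu, hH.hallTree_eq v hb hv]
  rfl

end Hall

/-! ## Filtrations of a topological group -/

section Filtration

theorem normal_closure_of_conj {G : Type*} [Group G] {s : Set G} (hs : ∀ a ∈ s, ∀ g : G, g * a * g⁻¹ ∈ s) :
    (Subgroup.closure s).Normal := by
  have : Group.conjugatesOfSet s ⊆ s := by
    intro b hb
    obtain ⟨a, ha, hab⟩ := Group.mem_conjugatesOfSet_iff.1 hb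
    obtain ⟨g, rfl⟩ := isConj_iff.1 hab
    exact hs a ha g
  have h2 : Subgroup.closure s = Subgroup.normalClosure s :=
    le_antisymm Subgroup.closure_le_normalClosure (Subgroup.closure_mono this)
  rw [h2]
  infer_instance

theorem commutator_le_of_rotate {G : Type*} [Group G] (A B C N : Subgroup G) [hN : N.Normal]
    (h1 : ⁅⁅B, C⁆, A⁆ ≤ N) (h2 : ⁅⁅C, A⁆, B⁆ ≤ N) : ⁅⁅A, B⁆, C⁆ ≤ N := by
  have key : ∀ K : Subgroup G, K.map (QuotientGroup.mk' N) = ⊥ ↔ K ≤ N := by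
    intro K
    rw [Subgroup.map_eq_bot_iff, QuotientGroup.ker_mk']
  rw [← key] at h1 h2 ⊢
  rw [Subgroup.map_commutator, Subgroup.map_commutator] at h1 h2 ⊢
  exact Subgroup.commutator_commutator_eq_bot_of_rotate h1 h2

variable (G : Type*) [Group G] [TopologicalSpace G] [IsTopologicalGroup G]

variable {G} in
/-- `[K, K']`: the closed subgroup generated by all commutators of elements of `K` and `K'`.
As `K` and `K'` are closed under inverses, the convention for commutators does not matter. -/
def closedComm (K K' : Subgroup G) : Subgroup G := ⁅K, K'⁆.topologicalClosure

variable {G} in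
/-- `K ^ m`: the closed subgroup generated by all `m`-th powers of elements of `K`. -/
def closedPow (K : Subgroup G) (m : ℕ) : Subgroup G :=
  (Subgroup.closure {g : G | ∃ k ∈ K, g = k ^ m}).topologicalClosure

/-- The closed lower central series `G^(i)`, `i ≥ 1`, with the dummy value `⊤` at `i = 0`. -/
def closedLCS : ℕ → Subgroup G
  | 0 => ⊤
  | 1 => ⊤
  | i + 2 => closedComm ⊤ (closedLCS (i + 1))

/-- The `p`-Zassenhaus filtration: `G_(n,p)` is the closed subgroup generated by all powers
`g ^ (p ^ j)`, with `g` in the `i`-th term of the closed lower central series and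
`i * p ^ j ≥ n`. -/
def zassenhaus (p n : ℕ) : Subgroup G :=
  (Subgroup.closure {g : G | ∃ i j : ℕ, 1 ≤ i ∧ n ≤ i * p ^ j ∧
    ∃ k ∈ closedLCS G i, g = k ^ p ^ j}).topologicalClosure

/-- The subgroup `(G_(n,p))^p [G, G_(n,p)]` of `G`. -/
def zassenhausDenom (p n : ℕ) : Subgroup G :=
  closedPow (zassenhaus G p n) p ⊔ closedComm ⊤ (zassenhaus G p n)

instance closedComm_normal (K K' : Subgroup G) [K.Normal] [K'.Normal] :
    (closedComm K K').Normal :=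
  Subgroup.is_normal_topologicalClosure _

instance closedPow_normal (K : Subgroup G) [hK : K.Normal] (m : ℕ) : (closedPow K m).Normal := by
  have : (Subgroup.closure {g : G | ∃ k ∈ K, g = k ^ m}).Normal := by
    refine normal_closure_of_conj ?_
    rintro _ ⟨k, hk, rfl⟩ g
    exact ⟨g * k * g⁻¹, hK.conj_mem k hk g, by rw [conj_pow]⟩
  exact Subgroup.is_normal_topologicalClosure _

instance closedLCS_normal : ∀ i : ℕ, (closedLCS G i).Normal
  | 0 => by rw [closedLCS]; infer_instance
  | 1 => by rw [closedLCS]; infer_instance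
  | i + 2 => by
    have := closedLCS_normal (i + 1)
    rw [closedLCS]; infer_instance

instance zassenhaus_normal (p n : ℕ) : (zassenhaus G p n).Normal := by
  have : (Subgroup.closure {g : G | ∃ i j : ℕ, 1 ≤ i ∧ n ≤ i * p ^ j ∧
      ∃ k ∈ closedLCS G i, g = k ^ p ^ j}).Normal := by
    refine normal_closure_of_conj ?_
    rintro _ ⟨i, j, hi, hj, k, hk, rfl⟩ g
    exact ⟨i, j, hi, hj, g * k * g⁻¹, (closedLCS_normal G i).conj_mem k hk g, by rw [conj_pow]⟩
  exact Subgroup.is_normal_topologicalClosure _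

instance zassenhausDenom_normal (p n : ℕ) : (zassenhausDenom G p n).Normal := by
  unfold zassenhausDenom; infer_instance

/-- The quotient `G_(n,p) / (G_(n,p))^p [G, G_(n,p)]`, a topological group with the quotient
topology. (The denominator is contained in `G_(n,p)`, see `zassenhausDenom_le`.) -/
abbrev ZassenhausQuotient (p n : ℕ) : Type _ :=
  ↥(zassenhaus G p n) ⧸ (zassenhausDenom G p n).subgroupOf (zassenhaus G p n)

theorem zassenhausDenom_le (p n : ℕ) : zassenhausDenom G p n ≤ zassenhaus G p n := by
  refine sup_le ?_ ?_
  · refine Subgroup.topologicalClosure_minimal _ ?_ (Subgroup.isClosed_topologicalClosure _)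
    rw [Subgroup.closure_le]
    rintro _ ⟨k, hk, rfl⟩
    exact Subgroup.pow_mem _ hk _
  · exact Subgroup.topologicalClosure_minimal _ (Subgroup.commutator_le_right _ _)
      (Subgroup.isClosed_topologicalClosure _)

theorem isClosed_closedLCS : ∀ i : ℕ, IsClosed (closedLCS G i : Set G)
  | 0 => by rw [closedLCS]; exact isClosed_univ
  | 1 => by rw [closedLCS]; exact isClosed_univ
  | i + 2 => by rw [closedLCS]; exact Subgroup.isClosed_topologicalClosure _

theorem commutator_closedLCS_le (i : ℕ) : ∀ j : ℕ, 1 ≤ j →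
    ⁅closedLCS G (i + 1), closedLCS G j⁆ ≤ closedLCS G (i + 1 + j) := by
  have hstep : ∀ j : ℕ, 1 ≤ j → ⁅(⊤ : Subgroup G), closedLCS G j⁆ ≤ closedLCS G (1 + j) := by
    intro j hj
    obtain ⟨j, rfl⟩ : ∃ k, j = k + 1 := ⟨j - 1, by omega⟩
    rw [show 1 + (j + 1) = j + 2 by ring, closedLCS]
    exact Subgroup.le_topologicalClosure _
  induction i with
  | zero => intro j hj; exact hstep j hj
  | succ i ih =>
    intro j hj
    have h0 : ⁅⁅(⊤ : Subgroup G), closedLCS G (i + 1)⁆, closedLCS G j⁆ ≤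
        closedLCS G (i + 1 + 1 + j) := by
      refine commutator_le_of_rotate _ _ _ _ ?_ ?_
      · refine (Subgroup.commutator_mono (ih j hj) le_rfl).trans ?_
        rw [Subgroup.commutator_comm]
        refine (hstep (i + 1 + j) (by omega)).trans (le_of_eq ?_)
        congr 1; ring
      · have : ⁅closedLCS G j, (⊤ : Subgroup G)⁆ ≤ closedLCS G (1 + j) := by
          rw [Subgroup.commutator_comm]; exact hstep j hj
        refine (Subgroup.commutator_mono this le_rfl).trans ?_
        rw [Subgroup.commutator_comm]
        refine (ih (1 + j) (by omega)).trans (le_of_eq ?_)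
        congr 1; ring
    rw [Subgroup.commutator_le]
    intro g hg h hh
    have hcl : IsClosed {g : G | ⁅g, h⁆ ∈ closedLCS G (i + 1 + 1 + j)} := by
      refine (isClosed_closedLCS G _).preimage ?_
      simp only [commutatorElement_def]
      fun_prop
    have hsub : ((⁅(⊤ : Subgroup G), closedLCS G (i + 1)⁆ : Subgroup G) : Set G) ⊆
        {g : G | ⁅g, h⁆ ∈ closedLCS G (i + 1 + 1 + j)} := fun g hg =>
      h0 (Subgroup.commutator_mem_commutator hg hh)
    exact closure_minimal hsub hcl hg

end Filtration

/-! ## Free profinite groups -/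

section Free

/-- `S` is a free profinite group on the basis `X`, via `ι : X → S`: the map `ι` converges to `1`
(every neighbourhood of `1` contains almost all `ι x`), its image generates `S` as a profinite
group, and every map from `X` to a profinite group which converges to `1` extends uniquely to a
continuous homomorphism. -/
structure IsFreeProfinite {X : Type v} (S : ProfiniteGrp.{u}) (ι : X → S) : Prop where
  convergent : Filter.Tendsto ι Filter.cofinite (𝓝 1)
  generates : (Subgroup.closure (Set.range ι)).topologicalClosure = ⊤
  lift : ∀ (G : ProfiniteGrp.{u}) (φ : X → G), Filter.Tendsto φ Filter.cofinite (𝓝 1) →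
    ∃! Φ : S →ₜ* G, ∀ x : X, Φ (ι x) = φ x

end Free

/-! ## The elements `σ_w` -/

section Sigma

/-- `j_n(i)`: the least `j` such that `i * p ^ j ≥ n`, for `1 ≤ i ≤ n`. -/
noncomputable def jExp (p n i : ℕ) : ℕ := sInf {j : ℕ | n ≤ i * p ^ j}

theorem jExp_spec {p n i : ℕ} (hp : p.Prime) (hi : 1 ≤ i) : n ≤ i * p ^ jExp p n i := by
  have hne : {j : ℕ | n ≤ i * p ^ j}.Nonempty :=
    ⟨n, (Nat.lt_pow_self hp.one_lt).le.trans (Nat.le_mul_of_pos_left _ hi)⟩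
  exact Nat.sInf_mem hne

/-- `J(n)`: the set of all `1 ≤ i ≤ n` with `i' p^(j_n(i')) ≥ i p^(j_n(i))` for all
`1 ≤ i' ≤ i`. -/
def setJ (p n : ℕ) : Set ℕ :=
  {i : ℕ | 1 ≤ i ∧ i ≤ n ∧ ∀ i' : ℕ, 1 ≤ i' → i' ≤ i → i * p ^ jExp p n i ≤ i' * p ^ jExp p n i'}

variable {X : Type v} {S : Type*} [Group S]

/-- The element `σ_w = τ_w ^ (p ^ j_n(i))` for a word `w` of length `i` of the Hall set. -/
noncomputable def sigma (p n : ℕ) (ι : X → S) (ℋ : Set (FreeMagma X)) (w : hallWords ℋ) : S :=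
  tau ι ℋ w ^ p ^ jExp p n (w : FreeMonoid X).length

variable [TopologicalSpace S] [IsTopologicalGroup S]

theorem foliage_length_pos (t : FreeMagma X) : 1 ≤ (foliage t).length := by
  induction t using FreeMagma.recOnMul with
  | ih1 x => exact le_rfl
  | ih2 a b iha ihb => rw [map_mul, FreeMonoid.length_mul]; omega

theorem treeComm_mem (ι : X → S) (t : FreeMagma X) :
    treeComm ι t ∈ closedLCS S (foliage t).length := by
  induction t using FreeMagma.recOnMul with
  | ih1 x => exact Subgroup.mem_top _
  | ih2 a b iha ihb =>
    rw [map_mul, FreeMonoid.length_mul]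
    obtain ⟨i, hi⟩ : ∃ i, (foliage a).length = i + 1 :=
      ⟨(foliage a).length - 1, by have := foliage_length_pos a; omega⟩
    have h := commutator_closedLCS_le S i _ (foliage_length_pos b)
    rw [← hi] at h
    have h3 := h (Subgroup.commutator_mem_commutator (Subgroup.inv_mem _ iha)
      (Subgroup.inv_mem _ ihb))
    rw [commutatorElement_def, inv_inv, inv_inv] at h3
    exact h3

/-- `σ_w` belongs to `S_(n,p)`. -/
theorem sigma_mem {p : ℕ} (hp : p.Prime) (n : ℕ) (ι : X → S) (ℋ : Set (FreeMagma X))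
    (w : hallWords ℋ) : sigma p n ι ℋ w ∈ zassenhaus S p n := by
  have hlen : 1 ≤ (w : FreeMonoid X).length := by
    rw [← foliage_hallTree]; exact foliage_length_pos _
  refine Subgroup.le_topologicalClosure _ (Subgroup.subset_closure
    ⟨(w : FreeMonoid X).length, _, hlen, jExp_spec hp hlen, tau ι ℋ w, ?_, rfl⟩)
  have h := treeComm_mem ι (hallTree ℋ w)
  rwa [foliage_hallTree] at h

/-- The coset of `σ_w` in `S_(n,p) / (S_(n,p))^p [S, S_(n,p)]`. -/
noncomputable def sigmaCoset (p : ℕ) [hp : Fact p.Prime] (n : ℕ) (ι : X → S)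
    (ℋ : Set (FreeMagma X)) (w : hallWords ℋ) : ZassenhausQuotient S p n :=
  QuotientGroup.mk ⟨sigma p n ι ℋ w, sigma_mem hp.out n ι ℋ w⟩

end Sigma

end Zassenhaus

open Zassenhaus

/-!
The proof is carried out for an arbitrary topological group `G` which is topologically generated by
the image of `X`; of the freeness of `S` only this is needed. Write `γ i` for the closed lower
central series. Let `T` be a closed subgroup of `G` that contains `zassenhausDenom G p n` and all
`σ_w` with the length of `w` in `setJ p n`. It has to be shown that `T` contains every power
`x ^ p ^ j` with `x ∈ γ i` and `i * p ^ j ≥ n`.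

This goes by induction on `j` (`pow_mem_of_treeComm_pow_mem`). It suffices to treat the least `i`
with `i * p ^ j ≥ n`, namely `⌈n / p ^ j⌉`. If already `i * p ^ j' ≥ n` for some `j' < j`, then
`x ^ p ^ j` is a power of a `p`-th power from the Zassenhaus subgroup. Otherwise
`j = jExp p n i` and `i ∈ setJ p n`. Now three facts combine.

* The power map `x ↦ x ^ p ^ j` is a homomorphism on `γ i` modulo `T`. By the Hall–Petrescu formula
  (`mul_pow_mem`) the error terms are `c ^ (p ^ j).choose k` with `c ∈ γ (k * i)` and `k ≥ 2`. If
  `v` is the valuation of `k`, the binomial coefficient is divisible by `p ^ (j - v)`, so for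
  `v > 0` the induction hypothesis applies, and for `v = 0` the next fact does
  (`pow_choose_mem`).
* The powers `x ^ p ^ j` with `x ∈ γ (i + 1)` lie in `T` (`pow_mem_of_succ_weight`): up to similar
  error terms, `⁅s, y⁆ ^ p ^ j` is `⁅s, y ^ p ^ j⁆`, which is a commutator of `s` with an element of
  the Zassenhaus subgroup.
* Modulo `γ (i + 1)`, the group `γ i` is topologically generated by the `τ_w` with `w` of length `i`
  (`closedLCS_le_topologicalClosure`). This is the fact that Hall trees span the free Lie ring,
  proved for commutators in the group itself by straightening
  (`treeComm_mul_mem_hallSpan`).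

The Hall–Petrescu formula is obtained from the theorem of Lazard and Leibman that polynomial
sequences in a filtered group form a group (`isPoly_group`): both `n ↦ (x * y) ^ n` and
`n ↦ ⁅s, y ^ n⁆` are products and commutators of sequences that are obviously polynomial, and
polynomial sequences have Taylor expansions with binomial exponents.
-/

namespace Zassenhaus

/-! ### Polynomial sequences in a filtered group -/

section Poly

variable {G : Type*} [Group G]

/-- `IsPoly γ d m a f`: the sequence `f` takes values in `γ a`, and its iterated differences of
order `k ≤ m` take values in `γ (a + k * d)`. The difference of `f` is `n ↦ (f n)⁻¹ * f (n + 1)`.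
The bound `m` on the order is what the proof of `isPoly_group` inducts on. -/
def IsPoly (γ : ℕ → Subgroup G) (d : ℕ) : ℕ → ℕ → (ℕ → G) → Prop
  | 0, a, f => ∀ n, f n ∈ γ a
  | m + 1, a, f => (∀ n, f n ∈ γ a) ∧ IsPoly γ d m (a + d) fun n => (f n)⁻¹ * f (n + 1)

variable {γ : ℕ → Subgroup G} {d m a b : ℕ} {f g : ℕ → G}

theorem IsPoly.mem (hf : IsPoly γ d m a f) (n : ℕ) : f n ∈ γ a := by
  cases m with
  | zero => exact hf n
  | succ m => exact hf.1 n

theorem IsPoly.mono (hγ : Antitone γ) (hab : a ≤ b) (hf : IsPoly γ d m b f) :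
    IsPoly γ d m a f := by
  induction m generalizing a b f with
  | zero => exact fun n => hγ hab (hf n)
  | succ m ih => exact ⟨fun n => hγ hab (hf.1 n), ih (Nat.add_le_add_right hab d) hf.2⟩

theorem IsPoly.of_succ (hf : IsPoly γ d (m + 1) a f) : IsPoly γ d m a f := by
  induction m generalizing a f with
  | zero => exact hf.1
  | succ m ih => exact ⟨hf.1, ih hf.2⟩

/-- The Lazard–Leibman theorem: polynomial sequences are closed under pointwise products and
inverses, and pointwise commutators add the weights. The three assertions need each other:
the differences of `f * g`, `f⁻¹` and `⁅f, g⁆` are products of commutators in `f`, `g` and their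
differences. -/
theorem isPoly_group (hγ : Antitone γ) (hc : ∀ a b, ⁅γ a, γ b⁆ ≤ γ (a + b)) (d m : ℕ) :
    (∀ a f g, IsPoly γ d m a f → IsPoly γ d m a g → IsPoly γ d m a (f * g)) ∧
    (∀ a f, IsPoly γ d m a f → IsPoly γ d m a f⁻¹) ∧
    (∀ a b f g, IsPoly γ d m a f → IsPoly γ d m b g → IsPoly γ d m (a + b) ⁅f, g⁆) := by
  have hcm : ∀ {a b x y}, x ∈ γ a → y ∈ γ b → ⁅x, y⁆ ∈ γ (a + b) := fun hx hy =>
    hc _ _ (Subgroup.commutator_mem_commutator hx hy)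
  induction m with
  | zero =>
    exact ⟨fun a f g hf hg n => mul_mem (hf n) (hg n), fun a f hf n => inv_mem (hf n),
      fun a b f g hf hg n => hcm (hf n) (hg n)⟩
  | succ m ih =>
    obtain ⟨hmul, hinv, hcomm⟩ := ih
    refine ⟨fun a f g hf hg => ⟨fun n => mul_mem (hf.mem n) (hg.mem n), ?_⟩,
      fun a f hf => ⟨fun n => inv_mem (hf.mem n), ?_⟩,
      fun a b f g hf hg => ⟨fun n => hcm (hf.mem n) (hg.mem n), ?_⟩⟩
    · obtain ⟨f', hf'⟩ : ∃ f', f' = fun n => (f n)⁻¹ * f (n + 1) := ⟨_, rfl⟩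
      obtain ⟨g', hg'⟩ : ∃ g', g' = fun n => (g n)⁻¹ * g (n + 1) := ⟨_, rfl⟩
      have pf : IsPoly γ d m (a + d) f' := hf' ▸ hf.2
      have pg : IsPoly γ d m (a + d) g' := hg' ▸ hg.2
      have key : (fun n => ((f * g) n)⁻¹ * (f * g) (n + 1)) = f' * ⁅f'⁻¹, g⁻¹⁆ * g' := by
        subst hf' hg'
        ext n
        simp only [commutatorElement_def, Pi.mul_apply, Pi.inv_apply]
        group
      rw [key]
      exact hmul _ _ _ (hmul _ _ _ pf
        ((hcomm _ _ _ _ (hinv _ _ pf) (hinv _ _ hg.of_succ)).mono hγ (by omega))) pg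
    · obtain ⟨f', hf'⟩ : ∃ f', f' = fun n => (f n)⁻¹ * f (n + 1) := ⟨_, rfl⟩
      have pf : IsPoly γ d m (a + d) f' := hf' ▸ hf.2
      have key : (fun n => ((f⁻¹) n)⁻¹ * (f⁻¹) (n + 1)) = ⁅f, f'⁻¹⁆ * f'⁻¹ := by
        subst hf'
        ext n
        simp only [commutatorElement_def, Pi.mul_apply, Pi.inv_apply]
        group
      rw [key]
      exact hmul _ _ _ ((hcomm _ _ _ _ hf.of_succ (hinv _ _ pf)).mono hγ (by omega))
        (hinv _ _ pf)
    · obtain ⟨f', hf'⟩ : ∃ f', f' = fun n => (f n)⁻¹ * f (n + 1) := ⟨_, rfl⟩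
      obtain ⟨g', hg'⟩ : ∃ g', g' = fun n => (g n)⁻¹ * g (n + 1) := ⟨_, rfl⟩
      have pf : IsPoly γ d m (a + d) f' := hf' ▸ hf.2
      have pg : IsPoly γ d m (b + d) g' := hg' ▸ hg.2
      have key : (fun n => (⁅f, g⁆ n)⁻¹ * ⁅f, g⁆ (n + 1)) =
          ⁅⁅f, g⁆⁻¹, ⁅f, ⁅f', g * g'⁆⁆ * ⁅f', g * g'⁆⁆ * (⁅f, ⁅f', g * g'⁆⁆ * ⁅f', g * g'⁆) *
            (⁅g, ⁅f, g'⁆⁆ * ⁅f, g'⁆) := by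
        subst hf' hg'
        ext n
        simp only [commutatorElement_def, Pi.mul_apply, Pi.inv_apply]
        group
      rw [key]
      have h1 : IsPoly γ d m (a + d + b) ⁅f', g * g'⁆ := hcomm _ _ _ _ pf
        (hmul _ _ _ hg.of_succ (pg.mono hγ (by omega)))
      have h2 : IsPoly γ d m (a + b + d) (⁅f, ⁅f', g * g'⁆⁆ * ⁅f', g * g'⁆) :=
        hmul _ _ _ ((hcomm _ _ _ _ hf.of_succ h1).mono hγ (by omega)) (h1.mono hγ (by omega))
      have h3 : IsPoly γ d m (a + (b + d)) ⁅f, g'⁆ := hcomm _ _ _ _ hf.of_succ pg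
      have h4 : IsPoly γ d m (a + b + d) (⁅g, ⁅f, g'⁆⁆ * ⁅f, g'⁆) :=
        hmul _ _ _ ((hcomm _ _ _ _ hg.of_succ h3).mono hγ (by omega)) (h3.mono hγ (by omega))
      exact hmul _ _ _ (hmul _ _ _ ((hcomm _ _ _ _ (hinv _ _
        (hcomm _ _ _ _ hf.of_succ hg.of_succ)) h2).mono hγ (by omega)) h2) h4

theorem isPoly_one (γ : ℕ → Subgroup G) (d m a : ℕ) : IsPoly γ d m a fun _ => 1 := by
  induction m generalizing a with
  | zero => exact fun n => one_mem _
  | succ m ih => exact ⟨fun n => one_mem _, by simpa using ih (a + d)⟩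

theorem isPoly_pow_choose (hγ : Antitone γ) {c : G} (k m a : ℕ) (hcm : c ∈ γ (a + k * d)) :
    IsPoly γ d m a fun n => c ^ n.choose k := by
  induction k generalizing m a with
  | zero =>
    have hc0 : c ∈ γ a := by simpa using hcm
    cases m with
    | zero => exact fun n => pow_mem hc0 _
    | succ m => exact ⟨fun n => pow_mem hc0 _, by simpa using isPoly_one γ d m (a + d)⟩
  | succ k ih =>
    have hc0 : c ∈ γ a := hγ (Nat.le_add_right _ _) hcm
    cases m with
    | zero => exact fun n => pow_mem hc0 _
    | succ m =>
      refine ⟨fun n => pow_mem hc0 _, ?_⟩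
      have := ih m (a + d) (by convert hcm using 2; ring)
      convert this using 2 with n
      beta_reduce
      rw [Nat.choose_succ_succ, add_comm (n.choose k), pow_add, inv_mul_cancel_left]

/-- If `f` vanishes before `k`, then `f k` is the difference of order `k` at `0`. -/
theorem IsPoly.mem_of_eq_one (k : ℕ) (hf : IsPoly γ d k a f) (h1 : ∀ n < k, f n = 1) :
    f k ∈ γ (a + k * d) := by
  induction k generalizing a f with
  | zero => simpa using hf 0
  | succ k ih =>
    have := ih hf.2 fun n hn => by rw [h1 n (by omega), h1 (n + 1) (by omega)]; simp
    rw [h1 k (by omega), inv_one, one_mul] at this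
    convert this using 2; ring

/-- Taylor expansion: a polynomial sequence with `f 0 = f 1 = 1` satisfies
`f q = ∏ k ∈ [2, q], c k ^ q.choose k` for suitable `c k ∈ γ (a + k * d)`. So `f q` lies in every
subgroup that contains all elements of the form of the factors. The sequences
`n ↦ c k ^ n.choose k` are split off one at a time, with `c k` the value at `k` of what is left. -/
theorem IsPoly.apply_mem (hγ : Antitone γ) (hc : ∀ a b, ⁅γ a, γ b⁆ ≤ γ (a + b))
    (hf : ∀ m, IsPoly γ d m a f) (h0 : f 0 = 1) (h1 : f 1 = 1) {q : ℕ} {T : Subgroup G}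
    (hT : ∀ k, 2 ≤ k → k ≤ q → ∀ c ∈ γ (a + k * d), c ^ q.choose k ∈ T) : f q ∈ T := by
  have key : ∀ r k : ℕ, 2 ≤ k → k + r = q + 1 → ∀ f : ℕ → G, (∀ m, IsPoly γ d m a f) →
      (∀ n < k, f n = 1) → f q ∈ T := by
    intro r
    induction r with
    | zero =>
      intro k _ hk f _ hf1
      rw [hf1 q (by omega)]
      exact one_mem T
    | succ r ih =>
      intro k hk2 hk f hf hf1
      have hck := (hf k).mem_of_eq_one k hf1
      have hr := ih (k + 1) (by omega) (by omega) ((fun n => f k ^ n.choose k)⁻¹ * f)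
        (fun m => (isPoly_group hγ hc d m).1 _ _ _ ((isPoly_group hγ hc d m).2.1 _ _
          (isPoly_pow_choose hγ k m a hck)) (hf m)) (by
          intro n hn
          rcases Nat.lt_succ_iff_lt_or_eq.1 hn with hn | rfl
          · simp [hf1 n hn, Nat.choose_eq_zero_of_lt hn]
          · simp)
      have := mul_mem (hT k hk2 (by omega) _ hck) hr
      simpa using this
  rcases Nat.lt_or_ge q 2 with hq | hq
  · have : f q = 1 := by interval_cases q <;> assumption
    rw [this]
    exact one_mem T
  · exact key (q - 1) 2 le_rfl (by omega) f hf fun n hn => by interval_cases n <;> assumption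

theorem isPoly_pow (hγ : Antitone γ) {c : G} (m : ℕ) (hcm : c ∈ γ (a + d)) :
    IsPoly γ d m a fun n => c ^ n := by
  simpa using isPoly_pow_choose hγ (d := d) 1 m a (by simpa using hcm)

/-- A consequence of the Hall–Petrescu formula: for `x`, `y` of weight `d`, the power
`(x * y) ^ q` is `x ^ q * y ^ q` times powers `c ^ q.choose k` with `c` of weight `k * d`. -/
theorem mul_pow_mem (hγ : Antitone γ) (hc : ∀ a b, ⁅γ a, γ b⁆ ≤ γ (a + b)) {x y : G}
    (hx : x ∈ γ d) (hy : y ∈ γ d) {q : ℕ} {T : Subgroup G}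
    (hT : ∀ k, 2 ≤ k → k ≤ q → ∀ c ∈ γ (k * d), c ^ q.choose k ∈ T)
    (hxT : x ^ q ∈ T) (hyT : y ^ q ∈ T) : (x * y) ^ q ∈ T := by
  have hP : ∀ {c : G} (m : ℕ), c ∈ γ d → IsPoly γ d m 0 fun n => c ^ n := fun m h =>
    isPoly_pow hγ m (by simpa using h)
  have := IsPoly.apply_mem (a := 0)
    (f := (fun n => y ^ n)⁻¹ * ((fun n => x ^ n)⁻¹ * fun n => (x * y) ^ n)) hγ hc (fun m => by
      obtain ⟨hmul, hinv, -⟩ := isPoly_group hγ hc d m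
      exact hmul _ _ _ (hinv _ _ (hP m hy)) (hmul _ _ _ (hinv _ _ (hP m hx))
        (hP m (mul_mem hx hy)))) (by simp) (by simp) (T := T) (q := q) (by simpa using hT)
  have := mul_mem hxT (mul_mem hyT this)
  simpa using this

/-- If `s` and `x` have weights `e` and `d`, then `⁅s, x⁆ ^ q` is `⁅s, x ^ q⁆` up to powers
`c ^ q.choose k` with `c` of weight `e + k * d`. -/
theorem commutator_pow_mem (hγ : Antitone γ) (hc : ∀ a b, ⁅γ a, γ b⁆ ≤ γ (a + b)) {e : ℕ}
    {s x : G} (hs : s ∈ γ e) (hx : x ∈ γ d) {q : ℕ} {T : Subgroup G}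
    (hT : ∀ k, 2 ≤ k → k ≤ q → ∀ c ∈ γ (e + k * d), c ^ q.choose k ∈ T)
    (hxT : ⁅s, x ^ q⁆ ∈ T) : ⁅s, x⁆ ^ q ∈ T := by
  have := IsPoly.apply_mem (a := e)
    (f := (fun n => ⁅s, x⁆ ^ n)⁻¹ * ⁅fun _ : ℕ => s, fun n => x ^ n⁆) hγ hc (fun m => by
      obtain ⟨hmul, hinv, hcomm⟩ := isPoly_group hγ hc d m
      refine hmul _ _ _ (hinv _ _ (isPoly_pow hγ m
        (hc _ _ (Subgroup.commutator_mem_commutator hs hx)))) ?_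
      refine hcomm e 0 _ _ ?_ (isPoly_pow hγ m (by simpa using hx))
      simpa using isPoly_pow_choose hγ (d := d) 0 m e (by simpa using hs))
    (by simp [commutatorElement_def]) (by simp [commutatorElement_def, mul_assoc]) (T := T) (q := q) hT
  have := mul_mem hxT (inv_mem this)
  simpa [commutatorElement_def, mul_assoc] using this

end Poly

/-! ### Commutators modulo the next term of a filtration -/

section Bilinear

variable {G : Type*} [Group G] {γ : ℕ → Subgroup G} {a b c : ℕ}

/-- The elements `x` of weight `a` with `⁅x, y⁆ ∈ M`, for `y` of weight `b` and `M` containing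
all elements of weight `a + b + 1`. They form a subgroup since commutators are bilinear modulo
weight `a + b + 1`. -/
def commSubgroup (hγ : Antitone γ) (hc : ∀ a b, ⁅γ a, γ b⁆ ≤ γ (a + b)) (ha : 1 ≤ a)
    {y : G} (hy : y ∈ γ b) {M : Subgroup G} (hM : γ (a + b + 1) ≤ M) : Subgroup G where
  carrier := {x | x ∈ γ a ∧ ⁅x, y⁆ ∈ M}
  one_mem' := ⟨one_mem _, by simp⟩
  mul_mem' := by
    rintro x z ⟨hx, hxM⟩ ⟨hz, hzM⟩
    refine ⟨mul_mem hx hz, ?_⟩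
    have h : ⁅x * z, y⁆ = ⁅x, ⁅z, y⁆⁆ * ⁅z, y⁆ * ⁅x, y⁆ := by
      simp only [commutatorElement_def]; group
    rw [h]
    have h1 := hc _ _ (Subgroup.commutator_mem_commutator hz hy)
    have h2 := hc _ _ (Subgroup.commutator_mem_commutator hx h1)
    exact mul_mem (mul_mem (hM (hγ (by omega) h2)) hzM) hxM
  inv_mem' := by
    rintro x ⟨hx, hxM⟩
    refine ⟨inv_mem hx, ?_⟩
    have h : ⁅x⁻¹, y⁆ = ⁅x⁻¹, ⁅x, y⁆⁻¹⁆ * ⁅x, y⁆⁻¹ := by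
      simp only [commutatorElement_def]; group
    rw [h]
    have h1 := inv_mem (hc _ _ (Subgroup.commutator_mem_commutator hx hy))
    have h2 := hc _ _ (Subgroup.commutator_mem_commutator (inv_mem hx) h1)
    exact mul_mem (hM (hγ (by omega) h2)) (inv_mem hxM)

theorem commutator_mem_swap {x y : G} {M : Subgroup G} : ⁅x, y⁆ ∈ M ↔ ⁅y, x⁆ ∈ M := by
  rw [← inv_mem_iff, commutatorElement_inv]

/-- The Jacobi identity modulo weight `a + b + c + 1`. It expresses that conjugation by `z` is
an endomorphism: compare `z * ⁅x, y⁆ * z⁻¹` with `⁅⁅z, x⁆ * x, ⁅z, y⁆ * y⁆`. -/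
theorem jacobi_mem (hγ : Antitone γ) (hc : ∀ a b, ⁅γ a, γ b⁆ ≤ γ (a + b)) (ha : 1 ≤ a)
    (hb : 1 ≤ b) (hc1 : 1 ≤ c) {x y z : G} (hx : x ∈ γ a) (hy : y ∈ γ b) (hz : z ∈ γ c)
    {M : Subgroup G} (hM : γ (a + b + c + 1) ≤ M) (h1 : ⁅⁅z, x⁆, y⁆ ∈ M)
    (h2 : ⁅⁅z, y⁆, x⁆ ∈ M) : ⁅z, ⁅x, y⁆⁆ ∈ M := by
  have hcm : ∀ {a b x y}, x ∈ γ a → y ∈ γ b → ⁅x, y⁆ ∈ γ (a + b) := fun hx hy =>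
    hc _ _ (Subgroup.commutator_mem_commutator hx hy)
  obtain ⟨u, hu⟩ : ∃ u, u = ⁅z, x⁆ := ⟨_, rfl⟩
  obtain ⟨v, hv⟩ : ∃ v, v = ⁅z, y⁆ := ⟨_, rfl⟩
  have hua : u ∈ γ (c + a) := hu ▸ hcm hz hx
  have hvb : v ∈ γ (c + b) := hv ▸ hcm hz hy
  rw [commutator_mem_swap, ← hv] at h2
  rw [← hu] at h1
  have hmem : ∀ {r x}, a + b + c + 1 ≤ r → x ∈ γ r → x ∈ M := fun h hx => hM (hγ h hx)
  have key : ⁅z, ⁅x, y⁆⁆ =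
      ⁅u, ⁅x, v * y⁆⁆ * (⁅x, v⁆ * ⁅v, ⁅x, y⁆⁆ *
        ⁅⁅x, y⁆, ⁅u, v⁆ * ⁅v, ⁅u, y⁆⁆ * ⁅u, y⁆⁆ * (⁅u, v⁆ * ⁅v, ⁅u, y⁆⁆ * ⁅u, y⁆)) := by
    subst hu hv
    simp only [commutatorElement_def]; group
  rw [key]
  have hxy := hcm hx hy
  have huy := hcm hua hy
  have huv := hcm hua hvb
  have hvuy := hcm hvb huy
  have hw : ⁅u, v⁆ * ⁅v, ⁅u, y⁆⁆ * ⁅u, y⁆ ∈ γ (c + a + b) :=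
    mul_mem (mul_mem (hγ (by omega) huv) (hγ (by omega) hvuy)) huy
  have hxvy : ⁅x, v * y⁆ ∈ γ (a + b) := hcm hx (mul_mem (hγ (by omega) hvb) hy)
  refine mul_mem (hmem (by omega) (hcm hua hxvy)) (mul_mem (mul_mem (mul_mem h2
    (hmem (by omega) (hcm hvb hxy))) (hmem (by omega) (hcm hxy hw)))
    (mul_mem (mul_mem (hmem (by omega) huv) (hmem (by omega) hvuy)) h1))

end Bilinear

/-! ### The closed lower central series -/

section LowerCentral

variable (G : Type*) [Group G] [TopologicalSpace G] [IsTopologicalGroup G]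

theorem closedLCS_antitone : Antitone (closedLCS G) := by
  refine antitone_nat_of_succ_le fun i => ?_
  match i with
  | 0 => exact le_top
  | i + 1 =>
    rw [closedLCS]
    exact Subgroup.topologicalClosure_minimal _ (Subgroup.commutator_le_right _ _)
      (isClosed_closedLCS G _)

theorem commutator_closedLCS_le_add (a b : ℕ) :
    ⁅closedLCS G a, closedLCS G b⁆ ≤ closedLCS G (a + b) := by
  match a, b with
  | 0, b => simpa using Subgroup.commutator_le_right _ _
  | a + 1, 0 => exact Subgroup.commutator_le_left _ _
  | a + 1, b + 1 => exact commutator_closedLCS_le G a _ (by omega)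

end LowerCentral

/-! ### Hall trees span the lower central quotients -/

section Straightening

variable {X : Type v}

theorem foliage_length_mul (a b : FreeMagma X) :
    (foliage (a * b)).length = (foliage a).length + (foliage b).length := by
  rw [map_mul, FreeMonoid.length_mul]

/-- The trees with at most `N` leaves, all of which are labelled by elements of `A`. -/
def boundedTrees (A : Set X) (N : ℕ) : Set (FreeMagma X) :=
  {t | (∀ x ∈ (foliage t).toList, x ∈ A) ∧ (foliage t).length ≤ N}

theorem boundedTrees_mul {A : Set X} {N : ℕ} {a b : FreeMagma X} :
    a * b ∈ boundedTrees A N ↔ (∀ x ∈ (foliage a).toList, x ∈ A) ∧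
      (∀ x ∈ (foliage b).toList, x ∈ A) ∧ (foliage a).length + (foliage b).length ≤ N := by
  change (_ ∧ _) ↔ _
  rw [foliage_length_mul, map_mul]
  simp only [FreeMonoid.toList_mul, List.mem_append]
  grind

theorem finite_boundedTrees {A : Set X} (hA : A.Finite) (N : ℕ) : (boundedTrees A N).Finite := by
  induction N with
  | zero =>
    convert Set.finite_empty
    ext t
    have := foliage_length_pos t
    simp only [boundedTrees, Set.mem_ofPred_eq, Set.mem_empty_iff_false, iff_false, not_and]
    omega
  | succ N ih =>
    refine ((hA.image FreeMagma.of).union (ih.image2 (· * ·) ih)).subset ?_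
    intro t ht
    induction t using FreeMagma.recOnMul with
    | ih1 x => exact Or.inl ⟨x, ht.1 x (by simp [foliage, FreeMonoid.toList_of]), rfl⟩
    | ih2 a b _ _ =>
      obtain ⟨ha, hb, hab⟩ := boundedTrees_mul.1 ht
      have := foliage_length_pos a
      have := foliage_length_pos b
      exact Or.inr ⟨a, ⟨ha, by omega⟩, b, ⟨hb, by omega⟩, rfl⟩

theorem treeComm_mul {G : Type*} [Group G] (ι : X → G) (a b : FreeMagma X) :
    treeComm ι (a * b) = ⁅(treeComm ι a)⁻¹, (treeComm ι b)⁻¹⁆ := by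
  rw [commutatorElement_def, inv_inv, inv_inv]
  rfl

variable {G : Type*} [Group G] [TopologicalSpace G] [IsTopologicalGroup G]

theorem commutator_treeComm_mem_iff (ι : X → G) (a b : FreeMagma X) {M : Subgroup G}
    (hM : closedLCS G ((foliage a).length + (foliage b).length + 1) ≤ M) :
    treeComm ι (a * b) ∈ M ↔ ⁅treeComm ι a, treeComm ι b⁆ ∈ M := by
  have key : ∀ x y : G, x ∈ closedLCS G (foliage a).length → y ∈ closedLCS G (foliage b).length →
      ⁅x, y⁆ ∈ M → ⁅x⁻¹, y⁻¹⁆ ∈ M := by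
    intro x y hx hy h
    have h1 : x⁻¹ ∈ commSubgroup (closedLCS_antitone G) (commutator_closedLCS_le_add G)
      (foliage_length_pos a) hy hM := inv_mem ⟨hx, h⟩
    have h2 : y⁻¹ ∈ commSubgroup (closedLCS_antitone G) (commutator_closedLCS_le_add G)
      (foliage_length_pos b) (inv_mem hx) (M := M) (by rwa [add_comm (foliage b).length]) :=
      inv_mem ⟨hy, commutator_mem_swap.1 h1.2⟩
    exact commutator_mem_swap.1 h2.2
  rw [treeComm_mul]
  have ha := treeComm_mem ι a
  have hb := treeComm_mem ι b
  exact ⟨fun h => by simpa using key _ _ (inv_mem ha) (inv_mem hb) h, key _ _ ha hb⟩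

/-- The subgroup generated by the commutators along the Hall trees of length `d` below `k` with
leaves in `A`, and by all elements of weight `d + 1`. -/
def hallSpan (ι : X → G) (ℋ : Set (FreeMagma X)) (le : FreeMagma X → FreeMagma X → Prop)
    (A : Set X) (d : ℕ) (k : FreeMagma X) : Subgroup G :=
  Subgroup.closure {g | ∃ t ∈ ℋ, t ∈ boundedTrees A d ∧ (foliage t).length = d ∧ le t k ∧ t ≠ k ∧
    treeComm ι t = g} ⊔ closedLCS G (d + 1)

theorem closedLCS_le_hallSpan (ι : X → G) (ℋ : Set (FreeMagma X))
    (le : FreeMagma X → FreeMagma X → Prop) (A : Set X) (d : ℕ) (k : FreeMagma X) :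
    closedLCS G (d + 1) ≤ hallSpan ι ℋ le A d k :=
  le_sup_right

variable {ℋ : Set (FreeMagma X)} {le : FreeMagma X → FreeMagma X → Prop}

/-- If the commutators of `y` with all generators of `hallSpan ι ℋ le A d k` lie in `M`, so do
the commutators of `y` with the elements of this subgroup. -/
theorem commutator_mem_of_mem_hallSpan (ι : X → G) {A : Set X} {d e : ℕ} (hd : 1 ≤ d)
    {k : FreeMagma X} {y : G} (hy : y ∈ closedLCS G e) {M : Subgroup G}
    (hM : closedLCS G (d + e + 1) ≤ M)
    (h : ∀ t ∈ ℋ, t ∈ boundedTrees A d → (foliage t).length = d → le t k → t ≠ k →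
      ⁅treeComm ι t, y⁆ ∈ M) {x : G} (hx : x ∈ hallSpan ι ℋ le A d k) : ⁅x, y⁆ ∈ M := by
  suffices hallSpan ι ℋ le A d k ≤ commSubgroup (closedLCS_antitone G)
      (commutator_closedLCS_le_add G) hd hy hM from (this hx).2
  refine sup_le ((Subgroup.closure_le _).2 ?_) fun z hz => ⟨closedLCS_antitone G (by omega) hz, ?_⟩
  · rintro g ⟨t, ht, htA, rfl, htk, htne, rfl⟩
    exact ⟨treeComm_mem ι t, h t ht htA rfl htk htne⟩
  · have := commutator_closedLCS_le_add G _ _ (Subgroup.commutator_mem_commutator hz hy)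
    exact hM (closedLCS_antitone G (by omega) this)

variable [LinearOrder X]

theorem hallSpan_mono (hH : IsHallSet ℋ le) (ι : X → G) (A : Set X) (d : ℕ) {k l : FreeMagma X}
    (hk : k ∈ ℋ) (hl : l ∈ ℋ) (hkl : le k l) :
    hallSpan ι ℋ le A d k ≤ hallSpan ι ℋ le A d l := by
  refine sup_le_sup_right (Subgroup.closure_mono ?_) _
  rintro g ⟨t, ht, htA, htd, htk, htne, rfl⟩
  refine ⟨t, ht, htA, htd, hH.le_trans t ht k hk l hl htk hkl, ?_, rfl⟩
  rintro rfl
  exact htne (hH.le_antisymm _ ht _ hk htk hkl)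

/-- Straightening: for Hall trees `h < k`, the commutator along `h * k` is, modulo higher weight,
a product of commutators along Hall trees below `k`. If `h * k` is not itself a Hall tree, then
`h = h₁ * h₂` with `h₁ < h₂ < k`, and the Jacobi identity expresses the commutator through
`⁅⁅h₁, k⁆, h₂⁆` and `⁅h₁, ⁅h₂, k⁆⁆`. The inner commutators are straightened by induction on `h`;
as this produces trees below `k`, the outer ones are then straightened by induction on `k`. The
latter is legitimate as only finitely many trees occur. -/
theorem treeComm_mul_mem_hallSpan (hH : IsHallSet ℋ le) (ι : X → G) {A : Set X} (hA : A.Finite)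
    (N : ℕ) (k : FreeMagma X) (hk : k ∈ ℋ) (hkA : k ∈ boundedTrees A N) (h : FreeMagma X)
    (hh : h ∈ ℋ) (hlt : le h k ∧ h ≠ k) (hhk : h * k ∈ boundedTrees A N) :
    treeComm ι (h * k) ∈ hallSpan ι ℋ le A ((foliage h).length + (foliage k).length) k := by
  let r : ↥(ℋ ∩ boundedTrees A N) → ↥(ℋ ∩ boundedTrees A N) → Prop :=
    fun a b => le a b ∧ a ≠ b
  have : Finite ↥(ℋ ∩ boundedTrees A N) := ((finite_boundedTrees hA N).inter_of_right ℋ).to_subtype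
  have hr : IsTrans _ r := ⟨fun a b c hab hbc => ⟨hH.le_trans _ a.2.1 _ b.2.1 _ c.2.1 hab.1 hbc.1, by
    rintro rfl
    exact hab.2 (Subtype.ext (hH.le_antisymm _ a.2.1 _ b.2.1 hab.1 hbc.1))⟩⟩
  have hr' : Std.Irrefl r := ⟨fun a h => h.2 rfl⟩
  have hwf : WellFounded r := Finite.wellFounded_of_trans_of_irrefl r
  suffices ∀ K : ↥(ℋ ∩ boundedTrees A N), ∀ h ∈ ℋ, le h K ∧ h ≠ K →
      h * (K : FreeMagma X) ∈ boundedTrees A N →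
      treeComm ι (h * K) ∈ hallSpan ι ℋ le A ((foliage h).length + (foliage K.1).length) K from
    this ⟨k, hk, hkA⟩ h hh hlt hhk
  clear hhk hlt hh h hkA hk k
  intro K
  induction K using hwf.induction with
  | _ K ihK =>
  obtain ⟨k, hk, hkA⟩ := K
  simp only at ihK ⊢
  -- The induction hypothesis on `k`, for two trees below `k` in either order.
  have small : ∀ u ∈ ℋ, ∀ v ∈ ℋ, le u k → u ≠ k → le v k → v ≠ k → u * v ∈ boundedTrees A N →
      ⁅treeComm ι u, treeComm ι v⁆ ∈
        hallSpan ι ℋ le A ((foliage u).length + (foliage v).length) k := by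
    intro u hu v hv huk huk' hvk hvk' huv
    have hle := closedLCS_le_hallSpan ι ℋ le A ((foliage u).length + (foliage v).length) k
    obtain ⟨huA, hvA, hN⟩ := boundedTrees_mul.1 huv
    by_cases heq : u = v
    · rw [heq, commutatorElement_self]
      exact one_mem _
    rcases hH.le_total u hu v hv with h | h
    · rw [← commutator_treeComm_mem_iff ι u v hle]
      exact hallSpan_mono hH ι A _ hv hk hvk (ihK ⟨v, hv, hvA, by omega⟩
        ⟨hvk, fun hc => hvk' (congrArg Subtype.val hc)⟩ u hu ⟨h, heq⟩ huv)
    · rw [commutator_mem_swap, ← commutator_treeComm_mem_iff ι v u (by rwa [add_comm (foliage v).length]),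
        add_comm (foliage u).length]
      exact hallSpan_mono hH ι A _ hu hk huk (ihK ⟨u, hu, huA, by omega⟩
        ⟨huk, fun hc => huk' (congrArg Subtype.val hc)⟩ v hv ⟨h, Ne.symm heq⟩
        (boundedTrees_mul.2 ⟨hvA, huA, (add_comm _ _).trans_le hN⟩))
  intro h
  induction h using FreeMagma.recOnMul with
  | ih1 x =>
    intro hh hlt hhk
    have hm : FreeMagma.of x * k ∈ ℋ := (hH.mul_mem_iff _ _).2 ⟨⟨hh, hk, hlt⟩, Or.inl ⟨x, rfl⟩⟩
    obtain ⟨-, h1, h2⟩ := hH.lt_right _ _ hm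
    rw [← foliage_length_mul]
    exact Subgroup.mem_sup_left (Subgroup.subset_closure
      ⟨_, hm, ⟨hhk.1, le_rfl⟩, rfl, h1, h2, rfl⟩)
  | ih2 h₁ h₂ ih₁ ih₂ =>
    intro hh hlt hhk
    obtain ⟨⟨hh₁, hh₂, hlt₁₂⟩, -⟩ := (hH.mul_mem_iff _ _).1 hh
    by_cases hm : h₁ * h₂ * k ∈ ℋ
    · obtain ⟨-, h1, h2⟩ := hH.lt_right _ _ hm
      rw [← foliage_length_mul]
      exact Subgroup.mem_sup_left (Subgroup.subset_closure
        ⟨_, hm, ⟨hhk.1, le_rfl⟩, rfl, h1, h2, rfl⟩)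
    have hnle : ¬ le k h₂ := fun hc =>
      hm ((hH.mul_mem_iff _ _).2 ⟨⟨hh, hk, hlt⟩, Or.inr ⟨h₁, h₂, rfl, hc⟩⟩)
    have h2k : le h₂ k := (hH.le_total _ hh₂ _ hk).resolve_right hnle
    have h2k' : h₂ ≠ k := by rintro rfl; exact hnle (hH.le_refl _ hk)
    have h1k : le h₁ k := hH.le_trans _ hh₁ _ hh₂ _ hk hlt₁₂.1 h2k
    have h1k' : h₁ ≠ k := by
      rintro rfl
      exact h2k' (hH.le_antisymm _ hh₂ _ hk h2k hlt₁₂.1)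
    obtain ⟨hA12, hkA', hN⟩ := boundedTrees_mul.1 hhk
    obtain ⟨hA1, hA2, -⟩ := boundedTrees_mul.1 (⟨hA12, le_rfl⟩ : h₁ * h₂ ∈ boundedTrees A _)
    rw [foliage_length_mul] at hN ⊢
    have p1 := foliage_length_pos h₁
    have p2 := foliage_length_pos h₂
    have p3 := foliage_length_pos k
    have m1 := treeComm_mem ι h₁
    have m2 := treeComm_mem ι h₂
    have m3 := treeComm_mem ι k
    obtain ⟨D, hD⟩ : ∃ D, (foliage h₁).length + (foliage h₂).length + (foliage k).length = D :=
      ⟨_, rfl⟩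
    rw [hD]
    have hle := closedLCS_le_hallSpan ι ℋ le A D k
    rw [commutator_treeComm_mem_iff ι _ _ (by rwa [foliage_length_mul, hD])]
    have c12 : ⁅treeComm ι k, ⁅treeComm ι h₁, treeComm ι h₂⁆⁆ ∈ hallSpan ι ℋ le A D k := by
      refine jacobi_mem (closedLCS_antitone G) (commutator_closedLCS_le_add G) p1 p2 p3 m1 m2 m3
        (by rwa [hD]) ?_ ?_
      · have e := ih₁ hh₁ ⟨h1k, h1k'⟩ (boundedTrees_mul.2 ⟨hA1, hkA', by omega⟩)
        rw [commutator_treeComm_mem_iff ι _ _ (closedLCS_le_hallSpan ..), commutator_mem_swap] at e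
        refine commutator_mem_of_mem_hallSpan ι (by omega) m2 ((closedLCS_antitone G
          (by omega)).trans hle) ?_ e
        intro t ht htA htd htk htk'
        have := small t ht h₂ hh₂ htk htk' h2k h2k' (boundedTrees_mul.2 ⟨htA.1, hA2, by omega⟩)
        rwa [htd, show (foliage h₁).length + (foliage k).length + (foliage h₂).length = D by
          omega] at this
      · have e := ih₂ hh₂ ⟨h2k, h2k'⟩ (boundedTrees_mul.2 ⟨hA2, hkA', by omega⟩)
        rw [commutator_treeComm_mem_iff ι _ _ (closedLCS_le_hallSpan ..), commutator_mem_swap] at e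
        refine commutator_mem_of_mem_hallSpan ι (by omega) m1 ((closedLCS_antitone G
          (by omega)).trans hle) ?_ e
        intro t ht htA htd htk htk'
        have := small t ht h₁ hh₁ htk htk' h1k h1k' (boundedTrees_mul.2 ⟨htA.1, hA1, by omega⟩)
        rwa [htd, show (foliage h₂).length + (foliage k).length + (foliage h₁).length = D by
          omega] at this
    have m12 := commutator_closedLCS_le_add G _ _ (Subgroup.commutator_mem_commutator m1 m2)
    let B := commSubgroup (closedLCS_antitone G) (commutator_closedLCS_le_add G)
      (Nat.le_add_right_of_le p1) m3 (a := (foliage h₁).length + (foliage h₂).length)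
      (M := hallSpan ι ℋ le A D k) (by rwa [hD])
    have hB : closedLCS G ((foliage h₁).length + (foliage h₂).length + 1) ≤ B := by
      intro w hw
      refine ⟨closedLCS_antitone G (by omega) hw, hle ?_⟩
      exact closedLCS_antitone G (by omega)
        (commutator_closedLCS_le_add G _ _ (Subgroup.commutator_mem_commutator hw m3))
    exact ((commutator_treeComm_mem_iff ι h₁ h₂ hB).2 ⟨m12, commutator_mem_swap.1 c12⟩).2

end Straightening

section Generation

variable {X : Type v} {G : Type*} [Group G] [TopologicalSpace G] [IsTopologicalGroup G]

/-- `commSubgroup` for the closed lower central series is closed if `M` is. -/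
theorem isClosed_commSubgroup {a b : ℕ} (ha : 1 ≤ a) {y : G} (hy : y ∈ closedLCS G b)
    {M : Subgroup G} (hM : closedLCS G (a + b + 1) ≤ M) (hcl : IsClosed (M : Set G)) :
    IsClosed (commSubgroup (closedLCS_antitone G) (commutator_closedLCS_le_add G) ha hy hM :
      Set G) := by
  refine (isClosed_closedLCS G a).inter (hcl.preimage (f := fun x => ⁅x, y⁆) ?_)
  simp only [commutatorElement_def]
  fun_prop

variable [LinearOrder X] {ℋ : Set (FreeMagma X)} {le : FreeMagma X → FreeMagma X → Prop}

/-- The commutators along the Hall trees of length `d` topologically generate the `d`-th term of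
the lower central series modulo the next one. -/
theorem closedLCS_le_topologicalClosure (hH : IsHallSet ℋ le) {ι : X → G}
    (hι : (Subgroup.closure (Set.range ι)).topologicalClosure = ⊤) {d : ℕ} (hd : 1 ≤ d) :
    closedLCS G d ≤ (Subgroup.closure {g | ∃ t ∈ ℋ, (foliage t).length = d ∧ treeComm ι t = g} ⊔
      closedLCS G (d + 1)).topologicalClosure := by
  induction d, hd using Nat.le_induction with
  | base =>
    rw [← top_le_iff] at hι
    refine le_top.trans (hι.trans (Subgroup.topologicalClosure_mono (le_sup_of_le_left
      (Subgroup.closure_mono ?_))))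
    rintro _ ⟨x, rfl⟩
    exact ⟨_, hH.of_mem x, rfl, rfl⟩
  | succ d hd ih =>
    obtain ⟨M, hM⟩ : ∃ M, M = (Subgroup.closure {g | ∃ t ∈ ℋ, (foliage t).length = d + 1 ∧
      treeComm ι t = g} ⊔ closedLCS G (d + 1 + 1)).topologicalClosure := ⟨_, rfl⟩
    rw [← hM]
    have hMcl : IsClosed (M : Set G) := hM ▸ Subgroup.isClosed_topologicalClosure _
    have hM1 : closedLCS G (d + 1 + 1) ≤ M :=
      hM ▸ le_sup_right.trans (Subgroup.le_topologicalClosure _)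
    have hM2 : ∀ t ∈ ℋ, (foliage t).length = d + 1 → treeComm ι t ∈ M := fun t ht htd =>
      hM ▸ Subgroup.le_topologicalClosure _ (Subgroup.mem_sup_left
        (Subgroup.subset_closure ⟨t, ht, htd, rfl⟩))
    obtain ⟨d', rfl⟩ : ∃ d', d = d' + 1 := ⟨d - 1, by omega⟩
    rw [closedLCS]
    refine Subgroup.topologicalClosure_minimal _ (Subgroup.commutator_le.2 fun s _ g hg => ?_) hMcl
    -- The case of a letter and a Hall tree is covered by the straightening of trees.
    have key : ∀ x : X, ∀ t ∈ ℋ, (foliage t).length = d' + 1 → ⁅ι x, treeComm ι t⁆ ∈ M := by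
      intro x t ht htd
      have hA : {y | y = x ∨ y ∈ (foliage t).toList}.Finite :=
        (Set.finite_singleton x).union (List.finite_toSet _)
      have hx1 : (foliage (FreeMagma.of x)).length = 1 := rfl
      have hxA : ∀ z ∈ (foliage (FreeMagma.of x)).toList,
          z ∈ {y | y = x ∨ y ∈ (foliage t).toList} := by
        intro z hz
        simp [foliage, FreeMonoid.toList_of] at hz
        exact Or.inl hz
      have htA : ∀ z ∈ (foliage t).toList, z ∈ {y | y = x ∨ y ∈ (foliage t).toList} :=
        fun z hz => Or.inr hz
      have hspan : ∀ k, hallSpan ι ℋ le {y | y = x ∨ y ∈ (foliage t).toList} (d' + 1 + 1) k ≤ M := by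
        intro k
        refine sup_le ((Subgroup.closure_le _).2 ?_) hM1
        rintro _ ⟨u, hu, -, hud, -, -, rfl⟩
        exact hM2 u hu hud
      by_cases heq : FreeMagma.of x = t
      · rw [← heq]
        change ⁅ι x, ι x⁆ ∈ M
        rw [commutatorElement_self]
        exact one_mem M
      change ⁅treeComm ι (FreeMagma.of x), treeComm ι t⁆ ∈ M
      rcases hH.le_total _ (hH.of_mem x) t ht with h | h
      · rw [← commutator_treeComm_mem_iff ι _ _ (by rwa [htd, hx1, add_comm 1])]
        have := treeComm_mul_mem_hallSpan hH ι hA (d' + 1 + 1) t ht ⟨htA, by omega⟩ _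
          (hH.of_mem x) ⟨h, heq⟩ (boundedTrees_mul.2 ⟨hxA, htA, by omega⟩)
        rw [htd, hx1, add_comm 1] at this
        exact hspan _ this
      · rw [commutator_mem_swap, ← commutator_treeComm_mem_iff ι _ _ (by rwa [htd, hx1])]
        have := treeComm_mul_mem_hallSpan hH ι hA (d' + 1 + 1) _ (hH.of_mem x)
          ⟨hxA, by omega⟩ t ht ⟨h, Ne.symm heq⟩ (boundedTrees_mul.2 ⟨htA, hxA, by omega⟩)
        rw [htd, hx1] at this
        exact hspan _ this
    have key2 : ∀ s : G, ∀ t ∈ ℋ, (foliage t).length = d' + 1 → ⁅treeComm ι t, s⁆ ∈ M := by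
      intro s t ht htd
      have htm : treeComm ι t ∈ closedLCS G (d' + 1) := htd ▸ treeComm_mem ι t
      have hM' : closedLCS G (1 + (d' + 1) + 1) ≤ M := by rwa [add_comm 1]
      have : (⊤ : Subgroup G) ≤ commSubgroup (closedLCS_antitone G)
          (commutator_closedLCS_le_add G) le_rfl htm hM' := by
        rw [← hι]
        refine Subgroup.topologicalClosure_minimal _ ((Subgroup.closure_le _).2 ?_)
          (isClosed_commSubgroup le_rfl htm hM' hMcl)
        rintro _ ⟨x, rfl⟩
        exact ⟨Subgroup.mem_top _, key x t ht htd⟩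
      exact commutator_mem_swap.1 (this (Subgroup.mem_top s)).2
    have hs1 : s ∈ closedLCS G 1 := Subgroup.mem_top s
    have : closedLCS G (d' + 1) ≤ commSubgroup (closedLCS_antitone G)
        (commutator_closedLCS_le_add G) hd hs1 hM1 := by
      refine ih.trans (Subgroup.topologicalClosure_minimal _ (sup_le
        ((Subgroup.closure_le _).2 ?_) fun z hz => ⟨closedLCS_antitone G (by omega) hz, ?_⟩)
        (isClosed_commSubgroup hd hs1 hM1 hMcl))
      · rintro _ ⟨t, ht, htd, rfl⟩
        exact ⟨htd ▸ treeComm_mem ι t, key2 s t ht htd⟩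
      · exact hM1 (commutator_closedLCS_le_add G _ _ (Subgroup.commutator_mem_commutator hz hs1))
    exact commutator_mem_swap.1 (this hg).2

end Generation

/-! ### Powers in the terms of the lower central series -/

section Powers

theorem pow_sub_dvd_choose {p j v m : ℕ} (hp : p.Prime) (hm : ¬ p ∣ m) (hv : v ≤ j) :
    p ^ (j - v) ∣ (p ^ j).choose (p ^ v * m) := by
  have hm0 : m ≠ 0 := by rintro rfl; exact hm (dvd_zero p)
  have hk : p ^ v * m ≠ 0 := mul_ne_zero (pow_ne_zero _ hp.ne_zero) hm0
  obtain ⟨k, hk⟩ := Nat.exists_eq_succ_of_ne_zero hk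
  obtain ⟨q, hq⟩ := Nat.exists_eq_succ_of_ne_zero (pow_ne_zero j hp.ne_zero)
  have h := Nat.add_one_mul_choose_eq q k
  rw [← Nat.succ_eq_add_one, ← Nat.succ_eq_add_one, ← hk, ← hq] at h
  have h1 : p ^ v * p ^ (j - v) ∣ p ^ v * (m * (p ^ j).choose (p ^ v * m)) := by
    rw [← pow_add, Nat.add_sub_cancel' hv]
    exact ⟨_, by rw [h]; ring⟩
  refine Nat.Coprime.dvd_of_dvd_mul_left ?_ (Nat.dvd_of_mul_dvd_mul_left (Nat.pow_pos hp.pos) h1)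
  exact Nat.Coprime.pow_left _ ((Nat.Prime.coprime_iff_not_dvd hp).2 hm)

variable {G : Type*} [Group G] [TopologicalSpace G] [IsTopologicalGroup G]

/-- Control of the error terms in the power formulas. If `v` is the valuation of `k`, the
binomial coefficient is a multiple of `p ^ (j - v)`. For `v > 0` the hypothesis `ih` on smaller
exponents applies, as `p ^ v ≤ k` gives `k * i * p ^ (j - v) ≥ i * p ^ j ≥ n`; for `v = 0`
the hypothesis `hT` on elements of weight `l` does. -/
theorem pow_choose_mem {p n i j e : ℕ} (hp : p.Prime) (hin : n ≤ i * p ^ j) {T : Subgroup G}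
    (ih : ∀ j' < j, ∀ r, 1 ≤ r → n ≤ r * p ^ j' → ∀ c ∈ closedLCS G r, c ^ p ^ j' ∈ T)
    (hi : 1 ≤ i) {l : ℕ} (hT : ∀ c ∈ closedLCS G l, c ^ p ^ j ∈ T) {k : ℕ} (hk : k ≠ 0)
    (hkl : l ≤ e + k * i) (hkj : k ≤ p ^ j) {c : G} (hc : c ∈ closedLCS G (e + k * i)) :
    c ^ (p ^ j).choose k ∈ T := by
  obtain ⟨v, m, hm, rfl⟩ := Nat.exists_eq_pow_mul_and_not_dvd hk p hp.ne_one
  have hm0 : 1 ≤ m := Nat.one_le_iff_ne_zero.2 (by rintro rfl; exact hm (dvd_zero p))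
  have hv : v ≤ j := (Nat.pow_le_pow_iff_right hp.one_lt).1
    ((Nat.le_mul_of_pos_right _ hm0).trans hkj)
  obtain ⟨b, hb⟩ := pow_sub_dvd_choose hp hm hv
  rw [hb, pow_mul]
  refine pow_mem ?_ b
  rcases Nat.eq_zero_or_pos v with rfl | hv0
  · exact hT c (closedLCS_antitone G hkl hc)
  · refine ih (j - v) (by omega) _ ?_ ?_ c hc
    · exact le_add_left (Nat.mul_pos (Nat.pos_of_ne_zero hk) hi)
    · calc n ≤ i * p ^ j := hin
        _ = p ^ v * 1 * i * p ^ (j - v) := by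
          conv_lhs => rw [← Nat.add_sub_cancel' hv, pow_add]
          ring
        _ ≤ (e + p ^ v * m * i) * p ^ (j - v) := by
          gcongr
          exact le_add_left (by gcongr)

/-- If the error terms of the power map on the elements of weight `i` lie in the closed subgroup
`T`, then the elements of weight `i` with `q`-th power in `T` form a closed subgroup. -/
theorem pow_mem_of_mem_topologicalClosure {i q : ℕ} {T : Subgroup G} (hcl : IsClosed (T : Set G))
    (hT : ∀ k, 2 ≤ k → k ≤ q → ∀ c ∈ closedLCS G (k * i), c ^ q.choose k ∈ T) {s : Set G}
    (hs : ∀ x ∈ s, x ∈ closedLCS G i ∧ x ^ q ∈ T) :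
    ∀ x ∈ (Subgroup.closure s).topologicalClosure, x ^ q ∈ T := by
  let P : Subgroup G :=
    { carrier := {x | x ∈ closedLCS G i ∧ x ^ q ∈ T}
      one_mem' := ⟨one_mem _, by simp⟩
      inv_mem' := fun h => ⟨inv_mem h.1, by rw [inv_pow]; exact inv_mem h.2⟩
      mul_mem' := fun hx hy => ⟨mul_mem hx.1 hy.1, mul_pow_mem (closedLCS_antitone G)
        (commutator_closedLCS_le_add G) hx.1 hy.1 hT hx.2 hy.2⟩ }
  have hP : IsClosed (P : Set G) :=
    (isClosed_closedLCS G i).inter (hcl.preimage (continuous_pow q))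
  exact fun x hx => (Subgroup.topologicalClosure_minimal _ ((Subgroup.closure_le P).2 hs) hP hx).2

theorem pow_mem_zassenhaus {p n i j : ℕ} (hi : 1 ≤ i) (h : n ≤ i * p ^ j) {x : G}
    (hx : x ∈ closedLCS G i) : x ^ p ^ j ∈ zassenhaus G p n :=
  Subgroup.le_topologicalClosure _ (Subgroup.subset_closure ⟨i, j, hi, h, x, hx, rfl⟩)

theorem closedLCS_le_zassenhausDenom {p n : ℕ} (hn : 1 ≤ n) :
    closedLCS G (n + 1) ≤ zassenhausDenom G p n := by
  obtain ⟨m, rfl⟩ : ∃ m, n = m + 1 := ⟨n - 1, by omega⟩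
  rw [closedLCS]
  refine le_sup_of_le_right (Subgroup.topologicalClosure_mono (Subgroup.commutator_mono le_rfl ?_))
  intro x hx
  simpa using pow_mem_zassenhaus (p := p) (n := m + 1) (j := 0) (by omega) (by simp) hx

/-- If `i * p ^ j ≥ n`, then the `p ^ j`-th powers of elements of weight `i + 1` lie in `T`.
By descending induction on `i`, the power map is a homomorphism modulo `T` on the elements of
weight `i + 1`, so that generators `⁅s, x⁆` suffice, and `⁅s, x⁆ ^ p ^ j` is congruent to
`⁅s, x ^ p ^ j⁆`. The induction starts since `T` contains the elements of weight `n + 1`. -/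
theorem pow_mem_of_succ_weight {p n j : ℕ} (hp : p.Prime) (hn : 1 ≤ n) {T : Subgroup G}
    (hcl : IsClosed (T : Set G)) (hD : zassenhausDenom G p n ≤ T)
    (ih : ∀ j' < j, ∀ r, 1 ≤ r → n ≤ r * p ^ j' → ∀ c ∈ closedLCS G r, c ^ p ^ j' ∈ T)
    {i : ℕ} (hi : 1 ≤ i) (hin : n ≤ i * p ^ j) :
    ∀ x ∈ closedLCS G (i + 1), x ^ p ^ j ∈ T := by
  suffices ∀ r i, n ≤ i + r → 1 ≤ i → n ≤ i * p ^ j → ∀ x ∈ closedLCS G (i + 1), x ^ p ^ j ∈ T from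
    this n i (Nat.le_add_left n i) hi hin
  clear hin hi i
  intro r
  induction r with
  | zero =>
    exact fun i h _ _ x hx => pow_mem (hD (closedLCS_le_zassenhausDenom hn
      (closedLCS_antitone G (by omega) hx))) _
  | succ r ihr =>
    intro i hir hi hin
    have hin' : n ≤ (i + 1) * p ^ j := hin.trans (Nat.mul_le_mul_right _ (Nat.le_succ i))
    have hnext := ihr (i + 1) (by omega) (by omega) hin'
    obtain ⟨l, rfl⟩ : ∃ l, i = l + 1 := ⟨i - 1, by omega⟩
    rw [closedLCS]
    refine pow_mem_of_mem_topologicalClosure (i := l + 1 + 1) hcl (fun k hk hkq c hc => ?_) ?_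
    · exact pow_choose_mem hp hin' (e := 0) ih (by omega) hnext (by omega) (by nlinarith) hkq
        (by simpa using hc)
    · rintro _ ⟨s, -, x, hx, rfl⟩
      have hs : s ∈ closedLCS G 1 := Subgroup.mem_top s
      refine ⟨?_, commutator_pow_mem (closedLCS_antitone G) (commutator_closedLCS_le_add G) hs hx
        (fun k hk hkq c hc => ?_) ?_⟩
      · rw [add_comm]
        exact commutator_closedLCS_le_add G _ _ (Subgroup.commutator_mem_commutator hs hx)
      · exact pow_choose_mem hp hin ih (by omega) hnext (by omega) (by nlinarith) hkq hc
      · exact hD (Subgroup.mem_sup_right (Subgroup.le_topologicalClosure _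
          (Subgroup.commutator_mem_commutator (Subgroup.mem_top s)
            (pow_mem_zassenhaus hi hin hx))))

/-- The `p ^ j`-th powers of elements of weight `i` lie in `T` whenever `i * p ^ j ≥ n`. -/
theorem pow_mem_of_treeComm_pow_mem {X : Type v} [LinearOrder X] {ℋ : Set (FreeMagma X)}
    {le : FreeMagma X → FreeMagma X → Prop} (hH : IsHallSet ℋ le) {ι : X → G}
    (hι : (Subgroup.closure (Set.range ι)).topologicalClosure = ⊤) {p n : ℕ} (hp : p.Prime)
    (hn : 1 ≤ n) {T : Subgroup G} (hcl : IsClosed (T : Set G)) (hD : zassenhausDenom G p n ≤ T)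
    (hτ : ∀ t ∈ ℋ, (foliage t).length ∈ setJ p n →
      treeComm ι t ^ p ^ jExp p n (foliage t).length ∈ T) (j : ℕ) :
    ∀ i, 1 ≤ i → n ≤ i * p ^ j → ∀ x ∈ closedLCS G i, x ^ p ^ j ∈ T := by
  induction j using Nat.strong_induction_on with
  | _ j ih =>
  -- The weight `⌈n / p ^ j⌉`.
  obtain ⟨i, hin, hmin⟩ : ∃ i, n ≤ i * p ^ j ∧ ∀ r, n ≤ r * p ^ j → i ≤ r := by
    classical
    have h : ∃ i, n ≤ i * p ^ j := ⟨n, Nat.le_mul_of_pos_right _ (Nat.pow_pos hp.pos)⟩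
    exact ⟨Nat.find h, Nat.find_spec h, fun r hr => Nat.find_min' h hr⟩
  have hi : 1 ≤ i := Nat.one_le_iff_ne_zero.2 (by rintro rfl; omega)
  suffices ∀ x ∈ closedLCS G i, x ^ p ^ j ∈ T from
    fun r _ hrn x hx => this x (closedLCS_antitone G (hmin r hrn) hx)
  have hsucc := pow_mem_of_succ_weight hp hn hcl hD ih hi hin
  by_cases hj : ∃ j' < j, n ≤ i * p ^ j'
  · -- Here the power is a `p`-th power of an element of the Zassenhaus subgroup.
    obtain ⟨j', hj', hin'⟩ := hj
    intro x hx
    obtain ⟨k, rfl⟩ : ∃ k, j = j' + 1 + k := ⟨j - (j' + 1), by omega⟩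
    rw [pow_add, pow_succ, pow_mul, pow_mul]
    exact pow_mem (hD (Subgroup.mem_sup_left (Subgroup.le_topologicalClosure _
      (Subgroup.subset_closure ⟨_, pow_mem_zassenhaus hi hin' hx, rfl⟩)))) _
  push Not at hj
  have hjexp : jExp p n i = j :=
    le_antisymm (Nat.sInf_le hin) (le_csInf ⟨j, hin⟩ fun b hb => by
      by_contra hlt
      exact absurd (hj b (not_le.1 hlt)) (not_lt.2 hb))
  have hiJ : i ∈ setJ p n := by
    refine ⟨hi, hmin n (Nat.le_mul_of_pos_right _ (Nat.pow_pos hp.pos)), fun r hr hri => ?_⟩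
    rw [hjexp]
    have hr' := jExp_spec (p := p) (n := n) hp hr
    rcases Nat.lt_or_ge (jExp p n r) j with hlt | hge
    · -- Impossible, as `jExp` is antitone.
      exact absurd (hj _ hlt) (not_lt.2 (hr'.trans (Nat.mul_le_mul_right _ hri)))
    · obtain ⟨k, hk⟩ : ∃ k, jExp p n r = j + k := ⟨_, (Nat.add_sub_cancel' hge).symm⟩
      rw [hk, add_comm, pow_add, ← mul_assoc] at hr' ⊢
      exact Nat.mul_le_mul_right _ (hmin _ hr')
  intro x hx
  have hgen := closedLCS_le_topologicalClosure hH hι hi hx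
  rw [← Subgroup.closure_eq (closedLCS G (i + 1)), ← Subgroup.closure_union] at hgen
  refine pow_mem_of_mem_topologicalClosure (i := i) hcl (fun k hk hkq c hc => ?_) ?_ x hgen
  · refine pow_choose_mem hp hin (e := 0) ih hi hsucc (by omega) ?_ hkq (by simpa using hc)
    nlinarith
  · rintro g (⟨t, ht, htd, rfl⟩ | hg)
    · refine ⟨htd ▸ treeComm_mem ι t, ?_⟩
      have := hτ t ht (htd ▸ hiJ)
      rwa [htd, hjexp] at this
    · exact ⟨closedLCS_antitone G (Nat.le_succ i) hg, hsucc g hg⟩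

end Powers

end Zassenhaus

theorem theorem4p7 (p : ℕ) [Fact p.Prime] (n : ℕ) (hn : 1 ≤ n)
    (X : Type v) [LinearOrder X] (S : ProfiniteGrp.{u}) (ι : X → S) (hS : IsFreeProfinite S ι)
    (ℋ : Set (FreeMagma X)) (le : FreeMagma X → FreeMagma X → Prop) (hH : IsHallSet ℋ le) :
    (Subgroup.closure {q : ZassenhausQuotient S p n | ∃ w : hallWords ℋ,
      (w : FreeMonoid X).length ∈ setJ p n ∧ q = sigmaCoset p n ι ℋ w}).topologicalClosure = ⊤ := by
  have hp : p.Prime := Fact.out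
  obtain ⟨K, hK⟩ : ∃ K, K = (Subgroup.closure {q : ZassenhausQuotient S p n | ∃ w : hallWords ℋ,
    (w : FreeMonoid X).length ∈ setJ p n ∧ q = sigmaCoset p n ι ℋ w}).topologicalClosure :=
    ⟨_, rfl⟩
  rw [← hK]
  have hKcl : IsClosed (K : Set (ZassenhausQuotient S p n)) :=
    hK ▸ Subgroup.isClosed_topologicalClosure _
  -- The preimage of `K` in `S`.
  let T : Subgroup S := (K.comap (QuotientGroup.mk' _)).map (zassenhaus S p n).subtype
  have hT : ∀ (x : S) (hx : x ∈ zassenhaus S p n),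
      x ∈ T ↔ (QuotientGroup.mk (⟨x, hx⟩ : zassenhaus S p n) : ZassenhausQuotient S p n) ∈ K := by
    intro x hx
    constructor
    · rintro ⟨y, hy, rfl⟩
      exact hy
    · exact fun h => ⟨⟨x, hx⟩, h, rfl⟩
  have hTcl : IsClosed (T : Set S) :=
    (Subgroup.isClosed_topologicalClosure _ : IsClosed (zassenhaus S p n : Set S))
      |>.isClosedEmbedding_subtypeVal.isClosedMap _ (hKcl.preimage QuotientGroup.continuous_mk)
  have hD : zassenhausDenom S p n ≤ T := by
    intro x hx
    rw [hT x (zassenhausDenom_le S p n hx)]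
    convert one_mem K
    exact (QuotientGroup.eq_one_iff _).2 hx
  have hτ : ∀ t ∈ ℋ, (foliage t).length ∈ setJ p n →
      treeComm ι t ^ p ^ jExp p n (foliage t).length ∈ T := by
    intro t ht htJ
    let w : hallWords ℋ := ⟨foliage t, t, ht, rfl⟩
    have hw : sigma p n ι ℋ w = treeComm ι t ^ p ^ jExp p n (foliage t).length := by
      rw [sigma, tau, hH.hallTree_eq w ht rfl]
    rw [← hw, hT _ (sigma_mem hp n ι ℋ w), hK]
    exact Subgroup.le_topologicalClosure _ (Subgroup.subset_closure ⟨w, htJ, rfl⟩)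
  have hle : zassenhaus S p n ≤ T := by
    refine Subgroup.topologicalClosure_minimal _ ((Subgroup.closure_le _).2 ?_) hTcl
    rintro _ ⟨i, j, hi, hij, x, hx, rfl⟩
    exact pow_mem_of_treeComm_pow_mem hH hS.generates hp hn hTcl hD hτ j i hi hij x hx
  refine (Subgroup.eq_top_iff' K).2 fun q => ?_
  obtain ⟨⟨x, hx⟩, rfl⟩ := QuotientGroup.mk_surjective q
  exact (hT x hx).1 (hle hx)
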